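/- For an integer $n\ge 2$ and an integer $m$, let $\mathcal{R}(m)=\mathcal{R}_n(m)$ be the number of quadruples of integers $(x_1,x_2,x_3,x_4)$ with $1\le x_i\le \frac n5-\frac{n}{\log n}$ for $i=1,\dots,4$ and $$x_1^2+x_2^2+x_3^2+x_4^2+(x_1+x_2+x_3+x_4-n)^2=2m+n .$$ Let $\mathcal{E}(n)$ be the set of integers $m$ with $\frac{n^2}{10}+\frac{n^2}{\log n}\le m\le \frac{n^2-n}{2}-\frac{n^2}{\log n}$ and $\mathcal{R}(m)=0$. Then $|\mathcal{E}(n)|=O\big(n^{2-\frac1{50}}\big)$; that is, there is an absolute constant $C>0$ such that $|\mathcal{E}(n)|\le C\,n^{2-\frac1{50}}$ for all integers $n\ge 2$. -/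

import Mathlib

/-- The set of integer solutions `(x₁, x₂, x₃, x₄)` of
`x₁² + x₂² + x₃² + x₄² + (x₁ + x₂ + x₃ + x₄ - n)² = 2m + n`
with `1 ≤ xᵢ ≤ n/5 - n/log n` for all `i`. -/
def solutionSet (n : ℕ) (m : ℤ) : Set (Fin 4 → ℤ) :=
  {x | (∀ i, 1 ≤ x i ∧ (x i : ℝ) ≤ (n : ℝ) / 5 - (n : ℝ) / Real.log n) ∧
    (∑ i, x i ^ 2) + ((∑ i, x i) - (n : ℤ)) ^ 2 = 2 * m + (n : ℤ)}

theorem solutionSet_finite (n : ℕ) (m : ℤ) : (solutionSet n m).Finite := by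
  refine (Set.Finite.pi' (t := fun _ : Fin 4 =>
    Set.Icc (1 : ℤ) ⌊(n : ℝ) / 5 - (n : ℝ) / Real.log n⌋)
    (fun _ => Set.finite_Icc _ _)).subset ?_
  intro x hx i
  exact ⟨(hx.1 i).1, Int.le_floor.2 (hx.1 i).2⟩

/-- `R(m)`: the number of solutions. -/
noncomputable def solutionCount (n : ℕ) (m : ℤ) : ℕ := (solutionSet n m).ncard

/-- The count is of a finite set, so it vanishes only when there is no solution. -/
theorem solutionCount_eq_zero_iff (n : ℕ) (m : ℤ) :
    solutionCount n m = 0 ↔ solutionSet n m = ∅ :=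
  Set.ncard_eq_zero (solutionSet_finite n m)

/-- The exceptional set: the integers `m` with
`n²/10 + n²/log n ≤ m ≤ (n² - n)/2 - n²/log n` and `R(m) = 0`. -/
def exceptionalSet (n : ℕ) : Set ℤ :=
  {m | (n : ℝ) ^ 2 / 10 + (n : ℝ) ^ 2 / Real.log n ≤ (m : ℝ) ∧
    (m : ℝ) ≤ ((n : ℝ) ^ 2 - (n : ℝ)) / 2 - (n : ℝ) ^ 2 / Real.log n ∧
    solutionCount n m = 0}

theorem exceptionalSet_finite (n : ℕ) : (exceptionalSet n).Finite := by
  refine (Set.finite_Icc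
    ⌈(n : ℝ) ^ 2 / 10 + (n : ℝ) ^ 2 / Real.log n⌉
    ⌊((n : ℝ) ^ 2 - (n : ℝ)) / 2 - (n : ℝ) ^ 2 / Real.log n⌋).subset ?_
  intro m hm
  exact ⟨Int.ceil_le.2 hm.1, Int.le_floor.2 hm.2.1⟩

/-!
For large `n` the exceptional set is empty, so the constant only has to absorb finitely many `n`.

Write `N = 2 m + n` and let `t = n - (x₁ + x₂ + x₃ + x₄)` be the fifth variable. Once `t`
is fixed, the other four must have sum `n - t` and sum of squares `N - t ^ 2`. By Cauchy's lemma
(`exists_four_of_sum_of_sum_sq`) this is solvable when `n - t` is odd and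
`K = 4 (N - t ^ 2) - (n - t) ^ 2` is nonnegative: then `K ≡ 3 (mod 8)` is a sum of three odd squares,
and all four variables lie within `√(3 K) / 4` of their mean `(n - t) / 4`. Since
`5 K = (20 N - 4 n ^ 2) - (5 t - n) ^ 2`, taking `5 t - n` just below `√(20 N - 4 n ^ 2)` makes
`K = O(n)`, so the variables are within `O(√n)` of the mean. The margins `n ^ 2 / log n` allowed on
`m` keep the mean at a distance of order at least `n / log n` from both ends of the box, so the
solution lies in the box (`solutionSet_nonempty`).

The three squares theorem for `k ≡ 3 (mod 8)` (`sum_three_squares_of_mod_eight`) is proved by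
Dirichlet's method: a prime in a suitable arithmetic progression and quadratic reciprocity give a
positive definite ternary form of determinant one that represents `k`, and Hermite reduction
(`ternary_form_sum_three_squares`) shows that all values of such a form are sums of three squares.
-/

/-! ### Sums of three squares -/

/-- Division with remainder of least absolute value. -/
theorem exists_balanced_shift (x : ℤ) {a : ℤ} (ha : 0 < a) :
    ∃ t : ℤ, -a ≤ 2 * (x + t * a) ∧ 2 * (x + t * a) ≤ a := by
  refine ⟨-((2 * x + a) / (2 * a)), ?_⟩
  have h1 := Int.emod_add_mul_ediv (2 * x + a) (2 * a)
  have h2 := Int.emod_nonneg (2 * x + a) (show 2 * a ≠ 0 by omega)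
  have h3 := Int.emod_lt_of_pos (2 * x + a) (show 0 < 2 * a by omega)
  constructor <;> nlinarith

/-- Gauss reduction: a positive definite binary form of determinant `D` takes, at the first column
of a unimodular matrix, a value `A'` with `3 A' ^ 2 ≤ 4 D`. -/
theorem exists_unimodular_small_value (A B C : ℤ) (hA : 0 < A) (hD : 0 < A * C - B ^ 2) :
    ∃ p q r s : ℤ, p * s - q * r = 1 ∧
      0 < A * p ^ 2 + 2 * B * p * r + C * r ^ 2 ∧
      3 * (A * p ^ 2 + 2 * B * p * r + C * r ^ 2) ^ 2 ≤ 4 * (A * C - B ^ 2) := by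
  obtain ⟨N, hN⟩ : ∃ N : ℕ, A.toNat = N := ⟨_, rfl⟩
  induction N using Nat.strong_induction_on generalizing A B C with
  | _ N ih =>
  obtain ⟨t, ht1, ht2⟩ := exists_balanced_shift B hA
  have hdet : A * (C + 2 * t * B + t ^ 2 * A) - (B + t * A) ^ 2 = A * C - B ^ 2 := by ring
  have hC : 0 < C + 2 * t * B + t ^ 2 * A := by
    have : 0 < A * (C + 2 * t * B + t ^ 2 * A) := by nlinarith [sq_nonneg (B + t * A)]
    exact pos_of_mul_pos_right this hA.le
  rcases lt_or_ge (C + 2 * t * B + t ^ 2 * A) A with hlt | hge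
  · obtain ⟨p, q, r, s, h1, h2, h3⟩ := ih (C + 2 * t * B + t ^ 2 * A).toNat (by omega)
      (C + 2 * t * B + t ^ 2 * A) (-(B + t * A)) A hC (by linarith) rfl
    have hval : A * (-r + t * p) ^ 2 + 2 * B * (-r + t * p) * p + C * p ^ 2 =
        (C + 2 * t * B + t ^ 2 * A) * p ^ 2 + 2 * (-(B + t * A)) * p * r + A * r ^ 2 := by ring
    refine ⟨-r + t * p, -s + t * q, p, q, by linear_combination h1, ?_, ?_⟩
    · rw [hval]; exact h2
    · rw [hval]; linarith
  · refine ⟨1, 0, 0, 1, by norm_num, by linarith, ?_⟩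
    have h4 : 4 * (B + t * A) ^ 2 ≤ A ^ 2 := by nlinarith
    have h5 : A * A ≤ A * (C + 2 * t * B + t ^ 2 * A) := mul_le_mul_of_nonneg_left hge hA.le
    nlinarith

/-- A positive definite binary form of determinant one only takes values that are sums of two
squares. -/
theorem binary_form_sum_two_squares (A B C : ℤ) (hA : 0 < A) (hD : A * C - B ^ 2 = 1) (y z : ℤ) :
    ∃ u v : ℤ, A * y ^ 2 + 2 * B * y * z + C * z ^ 2 = u ^ 2 + v ^ 2 := by
  obtain ⟨p, q, r, s, h1, h2, h3⟩ := exists_unimodular_small_value A B C hA (by omega)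
  set A' := A * p ^ 2 + 2 * B * p * r + C * r ^ 2 with hA'
  have hA1 : A' = 1 := by nlinarith
  set B' := A * p * q + B * (p * s + q * r) + C * r * s with hB'
  set C' := A * q ^ 2 + 2 * B * q * s + C * s ^ 2 with hC'
  have hdet : A' * C' - B' ^ 2 = 1 := by
    have : A' * C' - B' ^ 2 = (p * s - q * r) ^ 2 * (A * C - B ^ 2) := by
      rw [hA', hB', hC']; ring
    rw [this, h1, hD]; norm_num
  have hval : ∀ Y Z : ℤ, A * (p * Y + q * Z) ^ 2 + 2 * B * (p * Y + q * Z) * (r * Y + s * Z) +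
      C * (r * Y + s * Z) ^ 2 = A' * Y ^ 2 + 2 * B' * Y * Z + C' * Z ^ 2 := by
    intro Y Z; rw [hA', hB', hC']; ring
  have hy : p * (s * y - q * z) + q * (-r * y + p * z) = y := by linear_combination y * h1
  have hz : r * (s * y - q * z) + s * (-r * y + p * z) = z := by linear_combination z * h1
  have key := hval (s * y - q * z) (-r * y + p * z)
  rw [hy, hz, hA1] at key
  rw [hA1] at hdet
  refine ⟨(s * y - q * z) + B' * (-r * y + p * z), -r * y + p * z, ?_⟩
  rw [key]
  linear_combination (-r * y + p * z) ^ 2 * hdet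

/-- The inequality behind Hermite reduction: with `f` balanced and `a * b - f ^ 2` small, a
leading coefficient `a ≥ 2` can be traded for `b`. -/
theorem lt_of_hermite_reduced {a b f A : ℤ} (h2 : 1 < a) (hab : a * b - f ^ 2 = A)
    (hA : 3 * A ^ 2 ≤ 4 * a) (hf1 : -a ≤ 2 * f) (hf2 : 2 * f ≤ a) : b < a := by
  by_contra! hge
  have h4 : 4 * f ^ 2 ≤ a ^ 2 := by nlinarith
  have h5 : a * a ≤ a * b := mul_le_mul_of_nonneg_left hge (by omega)
  have h6 : 3 * a ^ 2 ≤ 4 * A := by nlinarith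
  have h7 : (3 * a ^ 2) ^ 2 ≤ (4 * A) ^ 2 := pow_le_pow_left₀ (by positivity) h6 2
  have h8 : a * (27 * a ^ 3) ≤ a * 64 := by linarith
  have h9 : 27 * a ^ 3 ≤ 64 := le_of_mul_le_mul_left h8 (by omega)
  have h10 : (2 : ℤ) ^ 3 ≤ a ^ 3 := pow_le_pow_left₀ (by norm_num) h2 3
  linarith

/-- A positive definite ternary form of determinant one only takes values that are sums of three
squares. As long as the leading coefficient exceeds one, Hermite reduction finds an equivalent form
whose leading coefficient is smaller. -/
theorem ternary_form_sum_three_squares (a b c d e f : ℤ) (ha : 0 < a) (hab : 0 < a * b - f ^ 2)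
    (hdet : a * b * c + 2 * d * e * f - a * d ^ 2 - b * e ^ 2 - c * f ^ 2 = 1) (x y z : ℤ) :
    ∃ u v w : ℤ, a * x ^ 2 + b * y ^ 2 + c * z ^ 2 + 2 * d * y * z + 2 * e * x * z + 2 * f * x * y =
      u ^ 2 + v ^ 2 + w ^ 2 := by
  obtain ⟨N, hN⟩ : ∃ N : ℕ, a.toNat = N := ⟨_, rfl⟩
  induction N using Nat.strong_induction_on generalizing a b c d e f x y z with
  | _ N ih =>
  have hG : (a * b - f ^ 2) * (a * c - e ^ 2) - (a * d - e * f) ^ 2 = a := by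
    linear_combination a * hdet
  rcases eq_or_lt_of_le (show 1 ≤ a from ha) with h1 | h2
  · subst h1
    obtain ⟨v, w, hvw⟩ := binary_form_sum_two_squares (1 * b - f ^ 2) (1 * d - e * f)
      (1 * c - e ^ 2) hab hG y z
    exact ⟨x + f * y + e * z, v, w, by linear_combination hvw⟩
  -- Minimise `a * b - f ^ 2` by a change of variables in `y, z`, then balance `f` by shifting `x`.
  obtain ⟨p, q, r, s, hps, hA0, hA1⟩ := exists_unimodular_small_value (a * b - f ^ 2)
    (a * d - e * f) (a * c - e ^ 2) hab (by omega)
  rw [hG] at hA1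
  generalize hA' :
    (a * b - f ^ 2) * p ^ 2 + 2 * (a * d - e * f) * p * r + (a * c - e ^ 2) * r ^ 2 = A' at hA0 hA1
  obtain ⟨t, ht1, ht2⟩ := exists_balanced_shift (f * p + e * r) ha
  obtain ⟨f', hf'⟩ : ∃ v, v = f * p + e * r + t * a := ⟨_, rfl⟩
  obtain ⟨b', hb'⟩ : ∃ v, v = b * p ^ 2 + 2 * d * p * r + c * r ^ 2 +
      2 * t * (f * p + e * r) + t ^ 2 * a := ⟨_, rfl⟩
  obtain ⟨e', he'⟩ : ∃ v, v = f * q + e * s := ⟨_, rfl⟩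
  obtain ⟨d', hd'⟩ : ∃ v, v = b * p * q + d * (p * s + q * r) + c * r * s + t * e' := ⟨_, rfl⟩
  obtain ⟨c', hc'⟩ : ∃ v, v = b * q ^ 2 + 2 * d * q * s + c * s ^ 2 := ⟨_, rfl⟩
  have hab' : a * b' - f' ^ 2 = A' := by rw [hb', hf', ← hA']; ring
  have hdet' : a * b' * c' + 2 * d' * e' * f' - a * d' ^ 2 - b' * e' ^ 2 - c' * f' ^ 2 = 1 := by
    have : a * b' * c' + 2 * d' * e' * f' - a * d' ^ 2 - b' * e' ^ 2 - c' * f' ^ 2 =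
        (p * s - q * r) ^ 2 *
          (a * b * c + 2 * d * e * f - a * d ^ 2 - b * e ^ 2 - c * f ^ 2) := by
      rw [hd', hb', hf', hc', he']; ring
    rw [this, hps, hdet]; norm_num
  have hb0 : 0 < b' := by
    have : 0 < a * b' := by linarith [sq_nonneg f']
    exact pos_of_mul_pos_right this ha.le
  have hlt : b' < a := lt_of_hermite_reduced h2 hab' hA1 (by rwa [hf']) (by rwa [hf'])
  have hval : ∀ X Y Z : ℤ, a * (X + t * Y) ^ 2 + b * (p * Y + q * Z) ^ 2 + c * (r * Y + s * Z) ^ 2 +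
      2 * d * (p * Y + q * Z) * (r * Y + s * Z) + 2 * e * (X + t * Y) * (r * Y + s * Z) +
      2 * f * (X + t * Y) * (p * Y + q * Z) =
      b' * Y ^ 2 + a * X ^ 2 + c' * Z ^ 2 + 2 * e' * X * Z + 2 * d' * Y * Z + 2 * f' * Y * X := by
    intro X Y Z; rw [hd', hb', hf', hc', he']; ring
  have hy : p * (s * y - q * z) + q * (-r * y + p * z) = y := by linear_combination y * hps
  have hz : r * (s * y - q * z) + s * (-r * y + p * z) = z := by linear_combination z * hps
  have hx : x - t * (s * y - q * z) + t * (s * y - q * z) = x := by ring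
  have key := hval (x - t * (s * y - q * z)) (s * y - q * z) (-r * y + p * z)
  rw [hy, hz, hx] at key
  rw [key]
  exact ih b'.toNat (by omega) b' a c' e' d' f' hb0 (by linarith) (by linarith) _ _ _ rfl

/-- The auxiliary prime for `k ≡ 3 (mod 8)`, from Dirichlet's theorem. As `b ≡ 1 (mod 8)` and
`p ≡ 1 (mod 4)`, reciprocity gives `(-b / p) = (p / b) = (-2p / b) = (1 - b k / b) = 1`. -/
theorem exists_prime_isSquare_neg {k : ℕ} (hk : k % 8 = 3) :
    ∃ p b : ℕ, p.Prime ∧ p % 2 = 1 ∧ b % 8 = 1 ∧ 2 * p + 1 = b * k ∧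
      IsSquare (((-b : ℤ)) : ZMod p) := by
  have hcop : ((k - 1) / 2).Coprime (4 * k) := by
    have h2 : ((k - 1) / 2).Coprime 2 := by
      rw [Nat.coprime_two_right, Nat.odd_iff]; omega
    refine Nat.Coprime.mul_right (by simpa using h2.pow_right 2) ?_
    have hk' : k = 1 + 2 * ((k - 1) / 2) := by omega
    rw [hk', Nat.add_sub_cancel_left, Nat.mul_div_cancel_left _ two_pos]
    simp
  obtain ⟨p, hpk, hp, hmod⟩ :=
    Nat.forall_exists_prime_gt_and_modEq (4 * k) (show 4 * k ≠ 0 by omega) hcop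
  obtain ⟨j, hj⟩ := (Nat.modEq_iff_dvd' (by omega)).1 hmod.symm
  have hpj : p = 4 * (k * j) + (k - 1) / 2 := by
    rw [mul_assoc] at hj; omega
  have hbk : 2 * p + 1 = (8 * j + 1) * k := by
    have : (8 * j + 1) * k = 8 * (k * j) + k := by ring
    omega
  have hp4 : p % 4 = 1 := by omega
  have : Fact p.Prime := ⟨hp⟩
  refine ⟨p, 8 * j + 1, hp, by omega, by omega, hbk, ?_⟩
  apply ZMod.isSquare_of_jacobiSym_eq_one
  have hodd : Odd (8 * j + 1) := ⟨4 * j, by ring⟩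
  have hpodd : Odd p := Nat.odd_iff.2 (by omega)
  have hchi : jacobiSym (-2) (8 * j + 1) = 1 := by
    rw [jacobiSym.at_neg_two hodd, ZMod.χ₈'_nat_eq_if_mod_eight]
    have h1 : (8 * j + 1) % 2 ≠ 0 := by omega
    have h2 : (8 * j + 1) % 8 = 1 := by omega
    simp [h1, h2]
  have hone : jacobiSym (-2 * (p : ℤ)) (8 * j + 1) = 1 := by
    rw [jacobiSym.mod_left' (a₂ := 1), jacobiSym.one_left]
    apply Int.emod_emod_of_dvd _ (dvd_refl _) |>.symm.trans
    have : (-2 * (p : ℤ)) = 1 + ((8 * j + 1 : ℕ) : ℤ) * (-k) := by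
      have : (2 * p + 1 : ℤ) = ((8 * j + 1 : ℕ) : ℤ) * k := by exact_mod_cast hbk
      linear_combination -this
    rw [this, Int.emod_emod_of_dvd _ (dvd_refl _), Int.add_mul_emod_self_left]
  rw [jacobiSym.mul_left, hchi, one_mul] at hone
  rw [jacobiSym.neg _ hpodd, ZMod.χ₄_nat_one_mod_four hp4, one_mul,
    jacobiSym.quadratic_reciprocity_one_mod_four (by omega) hpodd, hone]

/-- The case of Gauss's three squares theorem that Cauchy's lemma needs: with
`2 p = b k - 1` and `z ^ 2 ≡ -b (mod 2 p)`, the form with matrix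
`[[(z ^ 2 + b) / (2 p), z, 1], [z, 2 p, 0], [1, 0, k]]` has determinant one and represents `k`. -/
theorem sum_three_squares_of_mod_eight {k : ℤ} (hk0 : 0 ≤ k) (hk : k % 8 = 3) :
    ∃ u v w : ℤ, k = u ^ 2 + v ^ 2 + w ^ 2 := by
  lift k to ℕ using hk0
  obtain ⟨p, b, hp, hp2, hb8, hbk, hsq⟩ := exists_prime_isSquare_neg (k := k) (by omega)
  obtain ⟨z, hz⟩ : ∃ z : ℤ, (p : ℤ) ∣ z ^ 2 + b := by
    obtain ⟨y, hy⟩ := hsq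
    obtain ⟨z, rfl⟩ := ZMod.intCast_surjective y
    refine ⟨z, (ZMod.intCast_zmod_eq_zero_iff_dvd _ p).1 ?_⟩
    push_cast at hy ⊢
    linear_combination -hy
  obtain ⟨z, hz, hzodd⟩ : ∃ z : ℤ, (p : ℤ) ∣ z ^ 2 + b ∧ z % 2 = 1 := by
    rcases Int.emod_two_eq_zero_or_one z with h | h
    · refine ⟨z + p, ?_, by omega⟩
      have : (z + p) ^ 2 + b = z ^ 2 + b + p * (2 * z + p) := by ring
      rw [this]
      exact dvd_add hz (dvd_mul_right _ _)
    · exact ⟨z, hz, h⟩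
  have h2 : (2 : ℤ) ∣ z ^ 2 + b := by
    obtain ⟨w, hw⟩ : ∃ w, z = 2 * w + 1 := ⟨z / 2, by omega⟩
    have : z ^ 2 = 2 * (2 * w ^ 2 + 2 * w) + 1 := by rw [hw]; ring
    omega
  have hcop : IsCoprime (2 : ℤ) p := by
    rw [Int.isCoprime_iff_gcd_eq_one]
    exact (Nat.coprime_two_left (n := p)).2 (Nat.odd_iff.2 hp2)
  obtain ⟨a, ha⟩ := hcop.mul_dvd h2 hz
  have hp0 : (0 : ℤ) < p := by exact_mod_cast hp.pos
  have hb0 : (0 : ℤ) < b := by omega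
  have hbk' : (2 * p + 1 : ℤ) = b * k := by exact_mod_cast hbk
  have ha0 : 0 < a := by
    have : 0 < 2 * (p : ℤ) * a := by rw [← ha]; positivity
    exact pos_of_mul_pos_right this (by positivity)
  obtain ⟨u, v, w, h⟩ := ternary_form_sum_three_squares a (2 * p) k 0 1 z ha0 (by linarith)
    (by linear_combination -k * ha - hbk') 0 0 1
  exact ⟨u, v, w, by linear_combination h⟩

/-! ### Cauchy's lemma -/

theorem odd_of_three_squares_mod_four {u v w : ℤ} (h : (u ^ 2 + v ^ 2 + w ^ 2) % 4 = 3) :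
    u % 2 = 1 ∧ v % 2 = 1 ∧ w % 2 = 1 := by
  have key : ∀ x : ℤ, x % 2 = 1 ∨ x ^ 2 % 4 = 0 := fun x => by
    rcases Int.even_or_odd' x with ⟨y, rfl | rfl⟩
    · right; ring_nf; omega
    · left; omega
  have sq : ∀ x : ℤ, x ^ 2 % 4 = 0 ∨ x ^ 2 % 4 = 1 := fun x => by
    rcases Int.even_or_odd' x with ⟨y, rfl | rfl⟩ <;> ring_nf <;> omega
  have := key u; have := key v; have := key w
  have := sq u; have := sq v; have := sq w
  omega

/-- Cauchy's lemma: four integers with prescribed odd sum `s` and odd sum of squares `A`. They all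
lie close to the mean `s / 4` when `4 A - s ^ 2` is small. -/
theorem exists_four_of_sum_of_sum_sq {s A : ℤ} (hs : s % 2 = 1) (hA : A % 2 = 1)
    (hpos : 0 ≤ 4 * A - s ^ 2) :
    ∃ x : Fin 4 → ℤ, ∑ i, x i = s ∧ ∑ i, x i ^ 2 = A ∧
      ∀ i, (4 * x i - s) ^ 2 ≤ 3 * (4 * A - s ^ 2) := by
  have hmod : (4 * A - s ^ 2) % 8 = 3 := by
    obtain ⟨c, rfl⟩ : ∃ c, s = 2 * c + 1 := ⟨s / 2, by omega⟩
    have hc : c * (c + 1) % 2 = 0 := Int.even_iff.1 (Int.even_mul_succ_self c)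
    have : (2 * c + 1) ^ 2 = 4 * (c * (c + 1)) + 1 := by ring
    omega
  obtain ⟨u, v, w, h⟩ := sum_three_squares_of_mod_eight hpos hmod
  obtain ⟨hu, hv, hw⟩ := odd_of_three_squares_mod_four (u := u) (v := v) (w := w) (by omega)
  -- The sign of `w` is chosen to make `s + u + v + w` divisible by four.
  obtain ⟨w, h, hw, h4⟩ : ∃ w, 4 * A - s ^ 2 = u ^ 2 + v ^ 2 + w ^ 2 ∧ w % 2 = 1 ∧
      (s + u + v + w) % 4 = 0 := by
    rcases (show (s + u + v + w) % 4 = 0 ∨ (s + u + v + -w) % 4 = 0 by omega) with h' | h'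
    · exact ⟨w, h, hw, h'⟩
    · exact ⟨-w, by rw [h]; ring, by omega, h'⟩
  obtain ⟨x, hx⟩ : ∃ x, s + u + v + w = 4 * x := ⟨(s + u + v + w) / 4, by omega⟩
  obtain ⟨y, hy⟩ : ∃ y, s + u - v - w = 4 * y := ⟨(s + u - v - w) / 4, by omega⟩
  obtain ⟨z, hz⟩ : ∃ z, s - u + v - w = 4 * z := ⟨(s - u + v - w) / 4, by omega⟩
  obtain ⟨r, hr⟩ : ∃ r, s - u - v + w = 4 * r := ⟨(s - u - v + w) / 4, by omega⟩
  refine ⟨![x, y, z, r], ?_, ?_, ?_⟩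
  · simp [Fin.sum_univ_four]; omega
  · have h16 : 16 * (x ^ 2 + y ^ 2 + z ^ 2 + r ^ 2) = 16 * A := by
      have : 16 * (x ^ 2 + y ^ 2 + z ^ 2 + r ^ 2) =
          (4 * x) ^ 2 + (4 * y) ^ 2 + (4 * z) ^ 2 + (4 * r) ^ 2 := by ring
      rw [this, ← hx, ← hy, ← hz, ← hr]
      linear_combination -4 * h
    simp [Fin.sum_univ_four]; omega
  · have key : ∀ a b c : ℤ, (a + b + c) ^ 2 ≤ 3 * (a ^ 2 + b ^ 2 + c ^ 2) := fun a b c => by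
      linarith [sq_nonneg (a - b), sq_nonneg (b - c), sq_nonneg (a - c)]
    rw [h]
    intro i
    fin_cases i
    · have := key u v w
      rw [show u + v + w = 4 * x - s by omega] at this
      simpa using this
    · have := key u (-v) (-w)
      rw [show u + -v + -w = 4 * y - s by omega] at this
      simpa using this
    · have := key (-u) v (-w)
      rw [show -u + v + -w = 4 * z - s by omega] at this
      simpa using this
    · have := key (-u) (-v) w
      rw [show -u + -v + w = 4 * r - s by omega] at this
      simpa using this

/-! ### Placing the solution in the box -/

/-- An integer `t` with `n - t` odd and `5 t - n` just below a given real number. -/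
theorem exists_opposite_parity_near (n : ℤ) (r : ℝ) :
    ∃ t : ℤ, (n - t) % 2 = 1 ∧ (5 * t - n : ℝ) ≤ r ∧ r - 10 < 5 * t - n := by
  have h1 := Int.floor_le ((r - 4 * n - 5) / 10)
  have h2 := Int.lt_floor_add_one ((r - 4 * n - 5) / 10)
  refine ⟨n + 1 + 2 * ⌊(r - 4 * n - 5) / 10⌋, by omega, ?_, ?_⟩ <;> push_cast <;> linarith

/-- For large `n` every `m` in the range is represented. The hypotheses on `n` say that `log n` and
`√n / log n` are large. The last of the five variables is an integer `t` for which
`K = 4 (2 m + n - t ^ 2) - (n - t) ^ 2` satisfies `0 ≤ K ≤ 16 n`; Cauchy's lemma then puts the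
other four within `2 √n` of `(n - t) / 4`. -/
theorem solutionSet_nonempty {n : ℕ} {m : ℤ} (hL : 100 ≤ Real.log n)
    (hs : 100 * Real.log n ≤ √(n : ℝ))
    (h1 : (n : ℝ) ^ 2 / 10 + (n : ℝ) ^ 2 / Real.log n ≤ (m : ℝ))
    (h2 : (m : ℝ) ≤ ((n : ℝ) ^ 2 - (n : ℝ)) / 2 - (n : ℝ) ^ 2 / Real.log n) :
    (solutionSet n m).Nonempty := by
  obtain ⟨L, hLdef⟩ : ∃ L, L = Real.log n := ⟨_, rfl⟩
  obtain ⟨q, hq⟩ : ∃ q, q = √(n : ℝ) := ⟨_, rfl⟩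
  obtain ⟨y, hy⟩ : ∃ y, y = (n : ℝ) / L := ⟨_, rfl⟩
  rw [← hLdef] at hL hs h1 h2
  rw [← hq] at hs
  have hL0 : 0 < L := by linarith
  have hqq : q * q = n := by rw [hq]; exact Real.mul_self_sqrt (Nat.cast_nonneg n)
  have hq0 : 10000 ≤ q := by linarith
  have hyL : y * L = n := by rw [hy]; field_simp
  have hyq : 100 * q ≤ y := by
    rw [hy, le_div_iff₀ hL0]; nlinarith
  have hn2 : (n : ℝ) ^ 2 / L = L * y ^ 2 := by rw [← hyL]; field_simp
  rw [hn2] at h1 h2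
  have hn0 : (0 : ℝ) ≤ n := Nat.cast_nonneg n
  have hLy : 100 * y ^ 2 ≤ L * y ^ 2 := mul_le_mul_of_nonneg_right hL (sq_nonneg y)
  obtain ⟨W, hW⟩ : ∃ W : ℝ, W = 20 * (2 * m + n) - 4 * n ^ 2 := ⟨_, rfl⟩
  have hW1 : 40 * (L * y ^ 2) ≤ W := by rw [hW]; linarith
  have hW2 : W ≤ 16 * n ^ 2 - 40 * (L * y ^ 2) := by rw [hW]; linarith
  have hW0 : 0 ≤ W := by nlinarith
  obtain ⟨r, hr0, hrr⟩ : ∃ r : ℝ, 0 ≤ r ∧ r * r = W := ⟨√W, Real.sqrt_nonneg _,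
    Real.mul_self_sqrt hW0⟩
  have hr1 : 60 * y ≤ r := by
    apply le_of_sq_le_sq _ hr0
    nlinarith
  have hr2 : r ≤ 4 * n := by
    apply le_of_sq_le_sq _ (by positivity)
    nlinarith
  have hr3 : 5 * y ≤ 4 * n - r := by
    -- `(4 n - r) (4 n + r) ≥ 40 L y ^ 2 = 40 n y` and `4 n + r ≤ 8 n`.
    have hnpos : (0 : ℝ) < n := by rw [← hqq]; positivity
    have hny : L * y ^ 2 = n * y := by rw [← hyL]; ring
    have : 8 * (n : ℝ) * (5 * y) ≤ 8 * n * (4 * n - r) := by nlinarith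
    exact le_of_mul_le_mul_left this (by positivity)
  obtain ⟨t, hodd, ht1, ht2⟩ := exists_opposite_parity_near n r
  push_cast at ht1 ht2
  have hA : (2 * m + n - t ^ 2) % 2 = 1 := by
    have : t * (t + 1) % 2 = 0 := Int.even_iff.1 (Int.even_mul_succ_self t)
    have : t ^ 2 = t * (t + 1) - t := by ring
    omega
  have hK5 : 5 * (4 * (2 * (m : ℝ) + n - t ^ 2) - (n - t) ^ 2) =
      (r - (5 * t - n)) * (r + (5 * t - n)) := by
    linear_combination -hrr - hW
  have hr4 : 10 ≤ r := by linarith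
  have hK0 : 0 ≤ 4 * (2 * (m : ℝ) + n - t ^ 2) - (n - t) ^ 2 := by
    have : 0 ≤ (r - (5 * t - n)) * (r + (5 * t - n)) :=
      mul_nonneg (by linarith) (by linarith)
    linarith
  have hK1 : 4 * (2 * (m : ℝ) + n - t ^ 2) - (n - t) ^ 2 ≤ 16 * n := by
    have : (r - (5 * t - n)) * (r + (5 * t - n)) ≤ 10 * (2 * r) :=
      mul_le_mul (by linarith) (by linarith) (by linarith) (by norm_num)
    linarith
  obtain ⟨x, hx1, hx2, hx3⟩ := exists_four_of_sum_of_sum_sq hodd hA (by exact_mod_cast hK0)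
  refine ⟨x, fun i => ?_, ?_⟩
  · have hx : (4 * (x i : ℝ) - (n - t)) ^ 2 ≤ (8 * q) ^ 2 := by
      have : ((4 * (x i : ℝ) - (n - t)) ^ 2) ≤
          3 * (4 * (2 * (m : ℝ) + n - t ^ 2) - (n - t) ^ 2) := by exact_mod_cast hx3 i
      nlinarith
    obtain ⟨hx4, hx5⟩ := abs_le.1 (abs_le_of_sq_le_sq hx (by positivity))
    rw [← hLdef, ← hy]
    constructor
    · have : (1 : ℝ) ≤ x i := by linarith
      exact_mod_cast this
    · linarith
  · rw [hx1, hx2]; ring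

/-! ### The exceptional set -/

theorem eventually_log_large :
    ∀ᶠ n : ℕ in Filter.atTop, 100 ≤ Real.log n ∧ 100 * Real.log n ≤ √(n : ℝ) := by
  have h1 : ∀ᶠ x : ℝ in Filter.atTop, 100 ≤ Real.log x :=
    Real.tendsto_log_atTop.eventually_ge_atTop 100
  have h2 := (isLittleO_log_rpow_atTop (r := 1 / 2) (by norm_num)).bound
    (show (0 : ℝ) < 1 / 100 by norm_num)
  filter_upwards [tendsto_natCast_atTop_atTop.eventually (h1.and h2)] with n hx
  refine ⟨hx.1, ?_⟩
  have h3 := hx.2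
  rw [← Real.sqrt_eq_rpow, Real.norm_of_nonneg (by linarith [hx.1]),
    Real.norm_of_nonneg (Real.sqrt_nonneg _)] at h3
  linarith

/-- The exceptional set is empty for large `n`, which is stronger than a power saving. -/
theorem eventually_exceptionalSet_eq_empty :
    ∀ᶠ n : ℕ in Filter.atTop, exceptionalSet n = ∅ := by
  filter_upwards [eventually_log_large] with n hn
  refine Set.eq_empty_of_forall_notMem fun m hm => ?_
  exact (solutionSet_nonempty hn.1 hn.2 hm.1 hm.2.1).ne_empty
    ((solutionCount_eq_zero_iff n m).1 hm.2.2)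

theorem theorem4p5 :
    ∃ C : ℝ, 0 < C ∧ ∀ n : ℕ, 2 ≤ n →
      ((exceptionalSet n).ncard : ℝ) ≤ C * (n : ℝ) ^ (2 - 1 / 50 : ℝ) := by
  obtain ⟨n₀, hn₀⟩ := Filter.eventually_atTop.1 eventually_exceptionalSet_eq_empty
  have hC : (0 : ℝ) ≤ ∑ k ∈ Finset.range n₀, ((exceptionalSet k).ncard : ℝ) := by positivity
  refine ⟨1 + ∑ k ∈ Finset.range n₀, ((exceptionalSet k).ncard : ℝ), by linarith, fun n hn => ?_⟩
  rcases le_or_gt n₀ n with h | h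
  · rw [hn₀ n h, Set.ncard_empty, Nat.cast_zero]
    exact mul_nonneg (by linarith) (by positivity)
  · have h1 : ((exceptionalSet n).ncard : ℝ) ≤
        ∑ k ∈ Finset.range n₀, ((exceptionalSet k).ncard : ℝ) :=
      Finset.single_le_sum (f := fun k => ((exceptionalSet k).ncard : ℝ))
        (fun _ _ => Nat.cast_nonneg _) (Finset.mem_range.2 h)
    have h2 : (1 : ℝ) ≤ (n : ℝ) ^ (2 - 1 / 50 : ℝ) :=
      Real.one_le_rpow (by exact_mod_cast (by omega : 1 ≤ n)) (by norm_num)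
    exact (by linarith : ((exceptionalSet n).ncard : ℝ) ≤ _).trans
      (le_mul_of_one_le_right (by linarith) h2)
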